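/- Let $n$ and $M\ge 2$ be integers, $\sigma\ge 0$ and $\mathbf f\in\mathbf R^n$. Observe $\mathbf y=\mathbf f+\boldsymbol\xi$, where $\xi_1,\dots,\xi_n$ are i.i.d. $\mathcal N(0,\sigma^2)$. Let $A_1,\dots,A_M$ be deterministic real $n\times n$ matrices with Euclidean operator norm $\|A_j\|_{\mathrm{op}}\le 1$, let $\boldsymbol b_1,\dots,\boldsymbol b_M\in\mathbf R^n$ be deterministic vectors, and set $\hat{\boldsymbol\mu}_j=A_j\mathbf y+\boldsymbol b_j$. For $\boldsymbol\theta$ in the simplex $\Lambda^M=\{\boldsymbol\theta\in\mathbf R^M:\ \theta_j\ge 0 \text{ for all } j,\ \sum_{j=1}^M\theta_j=1\}$ let $$A_{\boldsymbol\theta}=\sum_{j=1}^M\theta_jA_j,\qquad \boldsymbol b_{\boldsymbol\theta}=\sum_{j=1}^M\theta_j\boldsymbol b_j,\qquad \hat{\boldsymbol\mu}_{\boldsymbol\theta}=A_{\boldsymbol\theta}\mathbf y+\boldsymbol b_{\boldsymbol\theta},$$ $$H(\boldsymbol\theta)=\|\hat{\boldsymbol\mu}_{\boldsymbol\theta}\|_2^2-2\,\mathbf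 y^T\hat{\boldsymbol\mu}_{\boldsymbol\theta}+2\sigma^2\,\mathrm{Tr}(A_{\boldsymbol\theta})+\frac12\sum_{j=1}^M\theta_j\|\hat{\boldsymbol\mu}_{\boldsymbol\theta}-\hat{\boldsymbol\mu}_j\|_2^2 .$$ Let $\hat{\boldsymbol\theta}$ be any measurable selection of a minimizer of $H$ over $\Lambda^M$, and write $\hat{\boldsymbol\mu}=\hat{\boldsymbol\mu}_{\hat{\boldsymbol\theta}}$. Then for every $x>0$, with probability greater than $1-2e^{-x}$, $$\|\hat{\boldsymbol\mu}-\mathbf f\|_2^2\le\min_{j=1,\dots,M}\|\hat{\boldsymbol\mu}_j-\mathbf f\|_2^2+46\,\sigma^2\,(2\log M+x).$$ Furthermore, both expectations below are finite and $$\mathbb E\|\hat{\boldsymbol\mu}-\mathbf f\|_2^2\le\mathbb E\Big[\min_{j=1,\dots,M}\|\hat{\boldsymbol\mu}_j-\mathbf f\|_2^2\Big]+92\,\sigma^2\log(eM).$$ -/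

import Mathlib

open MeasureTheory ProbabilityTheory
open scoped NNReal

noncomputable section

namespace AffineAggregation

/-- The observation `y = f + ξ` in the Euclidean space `ℝⁿ`, for a realization `ξ` of the noise. -/
def observation {n : ℕ} (f : EuclideanSpace ℝ (Fin n)) (ξ : Fin n → ℝ) :
    EuclideanSpace ℝ (Fin n) :=
  f + WithLp.toLp 2 ξ

/-- The Euclidean operator norm `sup_{x ≠ 0} ‖A x‖₂ / ‖x‖₂` of a square real matrix. -/
def opNorm {n : ℕ} (A : Matrix (Fin n) (Fin n) ℝ) : ℝ :=
  ‖Matrix.toEuclideanCLM (𝕜 := ℝ) A‖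

/-- The affine estimator `A y + b`. -/
def affineEst {n : ℕ} (A : Matrix (Fin n) (Fin n) ℝ) (b y : EuclideanSpace ℝ (Fin n)) :
    EuclideanSpace ℝ (Fin n) :=
  Matrix.toEuclideanCLM (𝕜 := ℝ) A y + b

/-- `A_θ = ∑ⱼ θⱼ Aⱼ`. -/
def mixMatrix {n M : ℕ} (A : Fin M → Matrix (Fin n) (Fin n) ℝ) (θ : Fin M → ℝ) :
    Matrix (Fin n) (Fin n) ℝ :=
  ∑ j, θ j • A j

/-- `b_θ = ∑ⱼ θⱼ bⱼ`. -/
def mixVec {n M : ℕ} (b : Fin M → EuclideanSpace ℝ (Fin n)) (θ : Fin M → ℝ) :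
    EuclideanSpace ℝ (Fin n) :=
  ∑ j, θ j • b j

/-- The aggregate `μ̂_θ = A_θ y + b_θ`. -/
def aggregate {n M : ℕ} (A : Fin M → Matrix (Fin n) (Fin n) ℝ)
    (b : Fin M → EuclideanSpace ℝ (Fin n)) (y : EuclideanSpace ℝ (Fin n)) (θ : Fin M → ℝ) :
    EuclideanSpace ℝ (Fin n) :=
  affineEst (mixMatrix A θ) (mixVec b θ) y

/-- Mallows' criterion `C_p(θ) = ‖μ̂_θ‖² - 2 yᵀ μ̂_θ + 2 σ² Tr A_θ`. -/
def mallowsCp {n M : ℕ} (σ : ℝ) (A : Fin M → Matrix (Fin n) (Fin n) ℝ)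
    (b : Fin M → EuclideanSpace ℝ (Fin n)) (y : EuclideanSpace ℝ (Fin n)) (θ : Fin M → ℝ) : ℝ :=
  ‖aggregate A b y θ‖ ^ 2 - 2 * inner ℝ y (aggregate A b y θ)
    + 2 * σ ^ 2 * (mixMatrix A θ).trace

/-- The `Q`-aggregation penalty `pen(θ) = ∑ⱼ θⱼ ‖μ̂_θ - μ̂ⱼ‖²`. -/
def qPenalty {n M : ℕ} (A : Fin M → Matrix (Fin n) (Fin n) ℝ)
    (b : Fin M → EuclideanSpace ℝ (Fin n)) (y : EuclideanSpace ℝ (Fin n)) (θ : Fin M → ℝ) : ℝ :=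
  ∑ j, θ j * ‖aggregate A b y θ - affineEst (A j) (b j) y‖ ^ 2

/-- The penalized criterion `H_pen = C_p + pen / 2`. -/
def penalizedCriterion {n M : ℕ} (σ : ℝ) (A : Fin M → Matrix (Fin n) (Fin n) ℝ)
    (b : Fin M → EuclideanSpace ℝ (Fin n)) (y : EuclideanSpace ℝ (Fin n)) (θ : Fin M → ℝ) : ℝ :=
  mallowsCp σ A b y θ + 1 / 2 * qPenalty A b y θ

/-- The set of minimizers of `H_pen` over the simplex. -/
def argminPenalized {n M : ℕ} (σ : ℝ) (A : Fin M → Matrix (Fin n) (Fin n) ℝ)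
    (b : Fin M → EuclideanSpace ℝ (Fin n)) (y : EuclideanSpace ℝ (Fin n)) : Set (Fin M → ℝ) :=
  {θ | θ ∈ stdSimplex ℝ (Fin M) ∧
    ∀ θ' ∈ stdSimplex ℝ (Fin M), penalizedCriterion σ A b y θ ≤ penalizedCriterion σ A b y θ'}

end AffineAggregation

end

/-!
The criterion is half the squared norm of `μ̂_θ` plus a linear function of `θ` on the simplex.
First-order optimality of `θ̂` in the direction of the vertex `k` therefore gains the term
`‖μ̂ₖ - μ̂‖² / 2`, which joins the penalty: for every `k`,
`‖μ̂ - f‖² - ‖μ̂ₖ - f‖² ≤ ∑ⱼ θ̂ⱼ Δⱼₖ`, with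
`Δⱼₖ = 2 ⟪ξ, μ̂ⱼ - μ̂ₖ⟫ - 2 σ² Tr (Aⱼ - Aₖ) - ‖μ̂ⱼ - μ̂ₖ‖² / 2`
(`norm_aggregate_sub_sq_le`). The bound is a convex combination of the deviations `Δⱼₖ`, so it is
at most their maximum.

Each deviation is a Gaussian quadratic form whose mean is compensated by its negative quadratic
term. For `B = Aⱼ - Aₖ`, of operator norm at most `2`, and `g = ξ / σ`, one diagonalizes
`Q = B + B† - B†B / 2`. The coordinates of `g` in an orthonormal eigenbasis `eᵢ` are independent
standard normal, and `𝔼 exp (a x² + b x) ≤ exp (a + 2 a² + b²)` for `a ≤ 1 / 4`. The eigenvalues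
are at most `2`, their squares at most `9 ‖B eᵢ‖²`, and their sum is
`2 Tr B - ∑ ‖B eᵢ‖² / 2`. This gives `𝔼 exp (Δⱼₖ / (46 σ²)) ≤ 1`
(`exp_affine_chaos_stdGaussian`).

The sum `S` of these exponentials over all pairs has mean at most `M²`, and the excess loss is at
most `46 σ² log S`. Markov's inequality gives the deviation bound with probability at least
`1 - exp (-x)`, and `log S ≤ S / M² - 1 + 2 log M` the bound in expectation.
-/

namespace AffineAggregation

/-! ### Exponential moments of Gaussian quadratic forms -/

/-- The bound `-log (1 - s) ≤ s + s²`, in exponential form; it holds for all `s ≤ 1 / 2`, including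
large negative values, as is needed for a quadratic form without a lower bound. -/
lemma one_le_one_sub_mul_exp {s : ℝ} (hs : s ≤ 1 / 2) : 1 ≤ (1 - s) * Real.exp (s + s ^ 2) := by
  rcases le_total s 0 with h | h
  · have h1 := Real.add_one_le_exp (s + s ^ 2)
    nlinarith [mul_le_mul_of_nonneg_left h1 (by linarith : 0 ≤ 1 - s),
      mul_nonneg (sq_nonneg s) (neg_nonneg.2 h)]
  · have h1 := Real.quadratic_le_exp_of_nonneg (by positivity : 0 ≤ s + s ^ 2)
    have h2 := mul_le_mul_of_nonneg_left h1 (by linarith : 0 ≤ 1 - s)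
    have h3 : 0 ≤ s ^ 2 * ((1 - s) * (1 + s) ^ 2 - 2 * s) := by
      apply mul_nonneg (sq_nonneg s)
      nlinarith [mul_nonneg h h, mul_nonneg (mul_nonneg h h) (sub_nonneg.2 hs)]
    nlinarith

lemma inv_sqrt_one_sub_two_mul_le {a : ℝ} (ha : a ≤ 1 / 4) :
    (√(1 - 2 * a))⁻¹ ≤ Real.exp (a + 2 * a ^ 2) := by
  have h := one_le_one_sub_mul_exp (s := 2 * a) (by linarith)
  have hpos : 0 < 1 - 2 * a := by linarith
  rw [inv_le_iff_one_le_mul₀ (Real.sqrt_pos.2 hpos)]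
  have h2 : Real.exp (2 * a + (2 * a) ^ 2) = Real.exp (a + 2 * a ^ 2) ^ 2 := by
    rw [← Real.exp_nat_mul]; congr 1; push_cast; ring
  rw [h2, ← Real.sq_sqrt hpos.le, ← mul_pow] at h
  rw [mul_comm]
  exact (one_le_sq_iff₀ (by positivity)).1 h

/-- Completing the square against the standard normal density. -/
lemma gaussianPDFReal_mul_exp_quadratic {a : ℝ} (ha : a < 1 / 2) (b x : ℝ) :
    gaussianPDFReal 0 1 x * Real.exp (a * x ^ 2 + b * x) =
      ((√(2 * Real.pi))⁻¹ * Real.exp (b ^ 2 / (2 * (1 - 2 * a)))) *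
        Real.exp (-(1 / 2 - a) * (x - b / (1 - 2 * a)) ^ 2) := by
  have h : 1 - 2 * a ≠ 0 := by linarith
  simp only [gaussianPDFReal, NNReal.coe_one, mul_one, sub_zero]
  rw [mul_assoc, mul_assoc, ← Real.exp_add, ← Real.exp_add]
  congr 2
  field_simp
  ring

lemma integrable_exp_quadratic_gaussianReal {a : ℝ} (ha : a < 1 / 2) (b : ℝ) :
    Integrable (fun x ↦ Real.exp (a * x ^ 2 + b * x)) (gaussianReal 0 1) := by
  rw [gaussianReal_of_var_ne_zero _ one_ne_zero, gaussianPDF_def,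
    integrable_withDensity_iff_integrable_smul₀' (by fun_prop) (by simp)]
  simp only [ENNReal.toReal_ofReal (gaussianPDFReal_nonneg _ _ _), smul_eq_mul,
    gaussianPDFReal_mul_exp_quadratic ha]
  exact ((integrable_exp_neg_mul_sq (by linarith : 0 < 1 / 2 - a)).comp_sub_right _).const_mul _

lemma integral_exp_quadratic_gaussianReal {a : ℝ} (ha : a < 1 / 2) (b : ℝ) :
    ∫ x, Real.exp (a * x ^ 2 + b * x) ∂(gaussianReal 0 1) =
      (√(1 - 2 * a))⁻¹ * Real.exp (b ^ 2 / (2 * (1 - 2 * a))) := by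
  have hpos : 0 < 1 - 2 * a := by linarith
  rw [integral_gaussianReal_eq_integral_smul one_ne_zero]
  simp only [smul_eq_mul, gaussianPDFReal_mul_exp_quadratic ha]
  rw [integral_const_mul,
    integral_sub_right_eq_self (fun x ↦ Real.exp (-(1 / 2 - a) * x ^ 2)), integral_gaussian,
    show Real.pi / (1 / 2 - a) = 2 * Real.pi / (1 - 2 * a) by
      have : (1 : ℝ) / 2 - a ≠ 0 := by linarith
      field_simp, Real.sqrt_div (by positivity)]
  have : √(2 * Real.pi) ≠ 0 := by positivity
  field_simp

lemma integral_exp_quadratic_gaussianReal_le {a : ℝ} (ha : a ≤ 1 / 4) (b : ℝ) :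
    ∫ x, Real.exp (a * x ^ 2 + b * x) ∂(gaussianReal 0 1) ≤
      Real.exp (a + 2 * a ^ 2 + b ^ 2) := by
  rw [integral_exp_quadratic_gaussianReal (by linarith), Real.exp_add _ (b ^ 2)]
  gcongr
  · exact inv_sqrt_one_sub_two_mul_le ha
  · exact div_le_self (sq_nonneg b) (by linarith)

section
variable {E ι : Type*} [NormedAddCommGroup E] [InnerProductSpace ℝ E] [FiniteDimensional ℝ E]
  [MeasurableSpace E] [BorelSpace E] [Fintype ι]

/-- A standard Gaussian vector has independent standard normal coordinates in every orthonormal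
basis, so the exponential moment of a diagonal quadratic form factorizes. -/
lemma exp_quadratic_stdGaussian (e : OrthonormalBasis ι ℝ E) {a : ι → ℝ}
    (ha : ∀ i, a i ≤ 1 / 4) (b : ι → ℝ) :
    Integrable (fun g ↦ Real.exp (∑ i, (a i * inner ℝ (e i) g ^ 2 + b i * inner ℝ (e i) g)))
      (stdGaussian E) ∧
    ∫ g, Real.exp (∑ i, (a i * inner ℝ (e i) g ^ 2 + b i * inner ℝ (e i) g)) ∂(stdGaussian E) ≤
      Real.exp (∑ i, (a i + 2 * a i ^ 2 + b i ^ 2)) := by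
  classical
  have hm : Measurable (fun x : ι → ℝ ↦ ∑ i, x i • e i) := by fun_prop
  have hc : Continuous
      (fun g : E ↦ Real.exp (∑ i, (a i * inner ℝ (e i) g ^ 2 + b i * inner ℝ (e i) g))) := by
    fun_prop
  have hcoord : ∀ (x : ι → ℝ) i, inner ℝ (e i) (∑ j, x j • e j) = x i := fun x i ↦
    e.orthonormal.inner_right_fintype x i
  rw [stdGaussian_eq_map_pi_orthonormalBasis e]
  constructor
  · rw [integrable_map_measure hc.aestronglyMeasurable hm.aemeasurable]
    simp only [Function.comp_def, hcoord, Real.exp_sum]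
    exact Integrable.fintype_prod (f := fun i x ↦ Real.exp (a i * x ^ 2 + b i * x))
      fun i ↦ integrable_exp_quadratic_gaussianReal (by linarith [ha i]) _
  · rw [integral_map hm.aemeasurable hc.aestronglyMeasurable]
    simp only [hcoord, Real.exp_sum]
    rw [integral_fintype_prod_eq_prod (f := fun i x ↦ Real.exp (a i * x ^ 2 + b i * x))]
    exact Finset.prod_le_prod (fun i _ ↦ integral_nonneg fun x ↦ (Real.exp_pos _).le)
      fun i _ ↦ integral_exp_quadratic_gaussianReal_le (ha i) _

/-- With `Q = B + B† - B†B / 2` the exponent is `⟪g, Q g⟫ + ⟪2 v - B† v, g⟫` up to constants. In an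
eigenbasis `e` of `Q` the eigenvalues satisfy `qᵢ ≤ 2` and `|qᵢ| ≤ 3 ‖B eᵢ‖`. Since
`∑ qᵢ - 2 tr B = -∑ ‖B eᵢ‖² / 2`, the second-order terms are absorbed by the negative quadratic
term of the exponent. -/
lemma exp_affine_chaos_stdGaussian (B : E →L[ℝ] E) (hB : ‖B‖ ≤ 2) (v : E) :
    Integrable (fun g ↦ Real.exp ((2 * inner ℝ g (B g + v)
      - 2 * LinearMap.trace ℝ E (B : E →ₗ[ℝ] E) - 1 / 2 * ‖B g + v‖ ^ 2) / 46)) (stdGaussian E) ∧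
    ∫ g, Real.exp ((2 * inner ℝ g (B g + v)
      - 2 * LinearMap.trace ℝ E (B : E →ₗ[ℝ] E) - 1 / 2 * ‖B g + v‖ ^ 2) / 46) ∂(stdGaussian E)
      ≤ 1 := by
  set B' := ContinuousLinearMap.adjoint B with hB'
  set Q : E →L[ℝ] E := B + B' - (1 / 2 : ℝ) • (B' ∘L B) with hQ
  have hQin : ∀ x y, inner ℝ (Q x) y =
      inner ℝ (B x) y + inner ℝ x (B y) - 1 / 2 * inner ℝ (B x) (B y) := by
    intro x y
    simp [hQ, hB', inner_add_left, inner_sub_left, inner_smul_left,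
      ContinuousLinearMap.adjoint_inner_left]
  have hsymm : (Q : E →ₗ[ℝ] E).IsSymmetric := by
    intro x y
    simp only [ContinuousLinearMap.coe_coe]
    rw [hQin, real_inner_comm (Q y) x, hQin, real_inner_comm x (B y), real_inner_comm (B x) y,
      real_inner_comm (B y) (B x)]
    ring
  set e := hsymm.eigenvectorBasis rfl
  set q := hsymm.eigenvalues rfl
  have hQe : ∀ i, Q (e i) = q i • e i := fun i ↦ hsymm.apply_eigenvectorBasis rfl i
  have hnorm : ∀ i, ‖e i‖ = 1 := fun i ↦ e.orthonormal.1 i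
  have hqi : ∀ i, q i = 2 * inner ℝ (e i) (B (e i)) - 1 / 2 * ‖B (e i)‖ ^ 2 := by
    intro i
    have h := hQin (e i) (e i)
    rw [hQe, inner_smul_left, real_inner_self_eq_norm_sq, hnorm, real_inner_self_eq_norm_sq,
      real_inner_comm] at h
    simp only [conj_trivial] at h
    linarith
  have hin : ∀ i, |inner ℝ (e i) (B (e i))| ≤ ‖B (e i)‖ := fun i ↦ by
    simpa [hnorm i] using abs_real_inner_le_norm (e i) (B (e i))
  have hBe : ∀ i, ‖B (e i)‖ ≤ 2 := fun i ↦ by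
    simpa [hnorm i] using B.le_of_opNorm_le hB (e i)
  -- `2 ⟪e, B e⟫ - ‖B e‖² / 2 ≤ 2 ‖B e‖ - ‖B e‖² / 2 ≤ 2`, whatever the norm of `B`
  have hq2 : ∀ i, q i ≤ 2 := fun i ↦ by
    rw [hqi]
    nlinarith [(abs_le.1 (hin i)).2, sq_nonneg (‖B (e i)‖ - 2)]
  have hqsq : ∀ i, q i ^ 2 ≤ 9 * ‖B (e i)‖ ^ 2 := fun i ↦ by
    have h1 := abs_le.1 (hin i)
    have h2 := hBe i
    have h0 := norm_nonneg (B (e i))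
    have : |q i| ≤ 3 * ‖B (e i)‖ := by
      rw [hqi, abs_le]; constructor <;> nlinarith
    nlinarith [sq_abs (q i), abs_nonneg (q i)]
  set u : E := (2 : ℝ) • v - B' v with hu
  have hunorm : ‖u‖ ≤ 4 * ‖v‖ := by
    have h1 : ‖B' v‖ ≤ 2 * ‖v‖ :=
      B'.le_of_opNorm_le (by rw [hB', LinearIsometryEquiv.norm_map]; exact hB) v
    calc ‖u‖ ≤ ‖(2 : ℝ) • v‖ + ‖B' v‖ := norm_sub_le _ _
      _ ≤ 4 * ‖v‖ := by rw [norm_smul, Real.norm_ofNat]; linarith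
  have hquad : ∀ g, inner ℝ (Q g) g = ∑ i, q i * inner ℝ (e i) g ^ 2 := by
    intro g
    rw [← e.sum_inner_mul_inner]
    refine Finset.sum_congr rfl fun i _ ↦ ?_
    have : inner ℝ (Q g) (e i) = inner ℝ g (Q (e i)) := hsymm g (e i)
    rw [this, hQe, inner_smul_right, real_inner_comm g (e i)]
    ring
  have hlin : ∀ g, inner ℝ u g = ∑ i, inner ℝ (e i) u * inner ℝ (e i) g := by
    intro g
    rw [← e.sum_inner_mul_inner]
    exact Finset.sum_congr rfl fun i _ ↦ by rw [real_inner_comm u (e i)]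
  set τ := LinearMap.trace ℝ E (B : E →ₗ[ℝ] E) with hτ
  have hexp : ∀ g, Real.exp ((2 * inner ℝ g (B g + v) - 2 * τ - 1 / 2 * ‖B g + v‖ ^ 2) / 46) =
      Real.exp ((-2 * τ - 1 / 2 * ‖v‖ ^ 2) / 46) *
      Real.exp (∑ i, (q i / 46 * inner ℝ (e i) g ^ 2 +
        inner ℝ (e i) u / 46 * inner ℝ (e i) g)) := by
    intro g
    rw [← Real.exp_add]
    congr 1
    have h1 : ∑ i, (q i / 46 * inner ℝ (e i) g ^ 2 + inner ℝ (e i) u / 46 * inner ℝ (e i) g) =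
        (inner ℝ (Q g) g + inner ℝ u g) / 46 := by
      rw [hquad, hlin, ← Finset.sum_add_distrib, Finset.sum_div]
      exact Finset.sum_congr rfl fun i _ ↦ by ring
    have h2 : inner ℝ u g = 2 * inner ℝ g v - inner ℝ (B g) v := by
      rw [hu, inner_sub_left, inner_smul_left, hB', ContinuousLinearMap.adjoint_inner_left,
        real_inner_comm v g, real_inner_comm v (B g)]
      simp
    rw [h1, h2, hQin, norm_add_sq_real, inner_add_right, real_inner_self_eq_norm_sq,
      real_inner_comm (B g) g]
    ring
  have key := exp_quadratic_stdGaussian e (a := fun i ↦ q i / 46) (fun i ↦ by linarith [hq2 i])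
    (fun i ↦ inner ℝ (e i) u / 46)
  simp only [hexp]
  refine ⟨key.1.const_mul _, ?_⟩
  rw [integral_const_mul]
  refine (mul_le_mul_of_nonneg_left key.2 (Real.exp_pos _).le).trans ?_
  rw [← Real.exp_add, Real.exp_le_one_iff]
  have htr : τ = ∑ i, inner ℝ (e i) (B (e i)) := LinearMap.trace_eq_sum_inner _ e
  -- `qᵢ / 46 + 2 (qᵢ / 46)² ≤ 2 ⟪eᵢ, B eᵢ⟫ / 46`, because `2 * 9 / 46 ≤ 1 / 2`
  have hsum : ∑ i, (q i / 46 + 2 * (q i / 46) ^ 2 + (inner ℝ (e i) u / 46) ^ 2) ≤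
      ∑ i, (2 * inner ℝ (e i) (B (e i)) / 46 + inner ℝ (e i) u ^ 2 / 46 ^ 2) :=
    Finset.sum_le_sum fun i _ ↦ by
      have := hqsq i
      have := hqi i
      nlinarith [sq_nonneg ‖B (e i)‖]
  have husq : ∑ i, inner ℝ (e i) u ^ 2 = ‖u‖ ^ 2 := e.sum_sq_inner_right u
  rw [Finset.sum_add_distrib (f := fun i ↦ 2 * inner ℝ (e i) (B (e i)) / 46), ← Finset.sum_div,
    ← Finset.sum_div, ← Finset.mul_sum, ← htr, husq] at hsum
  have : ‖u‖ ^ 2 ≤ 16 * ‖v‖ ^ 2 := by nlinarith [norm_nonneg u, norm_nonneg v]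
  -- the linear part is absorbed by `-‖v‖² / 2`, because `16 / 46 ≤ 1 / 2`
  nlinarith [sq_nonneg ‖v‖]

end

/-! ### The deterministic comparison at a minimizer -/

section
variable {n M : ℕ} {σ : ℝ} {A : Fin M → Matrix (Fin n) (Fin n) ℝ}
  {b : Fin M → EuclideanSpace ℝ (Fin n)} {f y : EuclideanSpace ℝ (Fin n)} {θ : Fin M → ℝ}

lemma aggregate_eq_sum (A : Fin M → Matrix (Fin n) (Fin n) ℝ)
    (b : Fin M → EuclideanSpace ℝ (Fin n)) (y : EuclideanSpace ℝ (Fin n)) (θ : Fin M → ℝ) :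
    aggregate A b y θ = ∑ j, θ j • affineEst (A j) (b j) y := by
  simp [aggregate, affineEst, mixMatrix, mixVec, Finset.sum_add_distrib, map_sum]

lemma sum_mul_norm_sub_sq {E ι : Type*} [NormedAddCommGroup E] [InnerProductSpace ℝ E] [Fintype ι]
    {θ : ι → ℝ} (hθ : ∑ j, θ j = 1) (m : ι → E) (z : E) :
    ∑ j, θ j * ‖m j - z‖ ^ 2 =
      ∑ j, θ j * ‖m j‖ ^ 2 - 2 * inner ℝ (∑ j, θ j • m j) z + ‖z‖ ^ 2 := by
  simp only [norm_sub_sq_real, sum_inner, inner_smul_left, conj_trivial, mul_add, mul_sub,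
    Finset.sum_add_distrib, Finset.sum_sub_distrib, ← Finset.sum_mul, hθ, one_mul, Finset.mul_sum]
  simp only [mul_left_comm]

/-- On the simplex the penalty turns the criterion into half the squared norm of the aggregate plus
a linear function of the weights. -/
lemma penalizedCriterion_eq (hθ : ∑ j, θ j = 1) :
    penalizedCriterion σ A b y θ = 1 / 2 * ‖∑ j, θ j • affineEst (A j) (b j) y‖ ^ 2 +
      ∑ j, θ j * (-2 * inner ℝ y (affineEst (A j) (b j) y) + 2 * σ ^ 2 * (A j).trace
        + 1 / 2 * ‖affineEst (A j) (b j) y‖ ^ 2) := by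
  have hpen := sum_mul_norm_sub_sq hθ (fun j ↦ affineEst (A j) (b j) y) (aggregate A b y θ)
  have htr : (mixMatrix A θ).trace = ∑ j, θ j * (A j).trace := by
    simp [mixMatrix, Matrix.trace_sum]
  have hin : inner ℝ y (aggregate A b y θ) = ∑ j, θ j * inner ℝ y (affineEst (A j) (b j) y) := by
    simp [aggregate_eq_sum, inner_sum, inner_smul_right]
  rw [← aggregate_eq_sum, real_inner_self_eq_norm_sq] at hpen
  simp only [penalizedCriterion, mallowsCp, qPenalty]
  simp only [norm_sub_rev (aggregate A b y θ), hpen, htr, hin, ← aggregate_eq_sum, mul_add,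
    Finset.sum_add_distrib]
  simp only [mul_left_comm (θ _), ← Finset.mul_sum]
  ring

/-- First-order optimality over the simplex, in the direction of a vertex, of a quadratic
criterion `‖∑ⱼ θⱼ mⱼ‖² / 2 + ∑ⱼ θⱼ cⱼ`. -/
lemma first_order_of_isMinOn_stdSimplex {E : Type*} [NormedAddCommGroup E] [InnerProductSpace ℝ E]
    {ι : Type*} [Fintype ι] [DecidableEq ι] (m : ι → E) (c : ι → ℝ) {θ : ι → ℝ}
    (hθ : θ ∈ stdSimplex ℝ ι)
    (hmin : ∀ θ' ∈ stdSimplex ℝ ι, 1 / 2 * ‖∑ j, θ j • m j‖ ^ 2 + ∑ j, θ j * c j ≤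
      1 / 2 * ‖∑ j, θ' j • m j‖ ^ 2 + ∑ j, θ' j * c j) (k : ι) :
    0 ≤ inner ℝ (∑ j, θ j • m j) (m k - ∑ j, θ j • m j) + (c k - ∑ j, θ j * c j) := by
  set μ := ∑ j, θ j • m j with hμ
  set C := ∑ j, θ j * c j with hC
  set G := inner ℝ μ (m k - μ) + (c k - C) with hG
  have step : ∀ t : ℝ, 0 < t → t ≤ 1 → 0 ≤ G + t * (1 / 2 * ‖m k - μ‖ ^ 2) := by
    intro t ht ht1
    have hmem : (1 - t) • θ + t • (Pi.single k 1 : ι → ℝ) ∈ stdSimplex ℝ ι :=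
      convex_stdSimplex ℝ ι hθ (single_mem_stdSimplex ℝ k) (by linarith) ht.le (by ring)
    have h := hmin _ hmem
    have h1 : ∑ j, ((1 - t) • θ + t • (Pi.single k 1 : ι → ℝ)) j • m j = μ + t • (m k - μ) := by
      simp only [Pi.add_apply, Pi.smul_apply, smul_eq_mul, add_smul, Finset.sum_add_distrib,
        mul_smul, ← Finset.smul_sum, ← hμ, Pi.single_apply, ite_smul, one_smul, zero_smul,
        Finset.sum_ite_eq', Finset.mem_univ, if_true]
      rw [smul_sub, sub_smul, one_smul]
      abel
    have h2 : ∑ j, ((1 - t) • θ + t • (Pi.single k 1 : ι → ℝ)) j * c j = C + t * (c k - C) := by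
      simp only [Pi.add_apply, Pi.smul_apply, smul_eq_mul, add_mul, Finset.sum_add_distrib,
        mul_assoc, ← Finset.mul_sum, ← hC, Pi.single_apply, ite_mul, one_mul, zero_mul,
        Finset.sum_ite_eq', Finset.mem_univ, if_true]
      ring
    rw [h1, h2, norm_add_sq_real, inner_smul_right, norm_smul, mul_pow, Real.norm_eq_abs,
      sq_abs] at h
    have h3 : 0 ≤ t * (G + t * (1 / 2 * ‖m k - μ‖ ^ 2)) := by rw [hG]; linarith
    exact nonneg_of_mul_nonneg_right h3 ht
  by_contra! hneg
  set D := 1 / 2 * ‖m k - μ‖ ^ 2 with hD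
  have hD0 : 0 ≤ D := by positivity
  have hden : 0 < D - G := by linarith
  -- the step `t = -G / (2 (D - G))` makes the perturbation too small to compensate `G < 0`
  have ht : 0 < -G / (2 * (D - G)) := by apply div_pos <;> linarith
  have h := step _ ht (by rw [div_le_one (by linarith)]; linarith)
  have : -G / (2 * (D - G)) * D ≤ -G / 2 := by
    rw [div_mul_eq_mul_div, div_le_div_iff₀ (by linarith) (by norm_num)]
    nlinarith
  linarith

variable (σ A b f y) in
/-- The stochastic term which controls the excess loss of the aggregate for the pair of estimators
`j`, `k`: with `ξ = y - f` it is
`2 ⟪ξ, μ̂ⱼ - μ̂ₖ⟫ - 2 σ² Tr (Aⱼ - Aₖ) - ‖μ̂ⱼ - μ̂ₖ‖² / 2`. -/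
noncomputable def pairDeviation (j k : Fin M) : ℝ :=
  2 * inner ℝ (y - f) (affineEst (A j) (b j) y - affineEst (A k) (b k) y)
    - 2 * σ ^ 2 * (A j - A k).trace
    - 1 / 2 * ‖affineEst (A j) (b j) y - affineEst (A k) (b k) y‖ ^ 2

/-- The penalty and the strong convexity of the criterion together provide the negative quadratic
term of `pairDeviation`. -/
lemma norm_aggregate_sub_sq_le (hθ : θ ∈ argminPenalized σ A b y) (k : Fin M) :
    ‖aggregate A b y θ - f‖ ^ 2 ≤ ‖affineEst (A k) (b k) y - f‖ ^ 2 +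
      ∑ j, θ j * pairDeviation σ A b f y j k := by
  obtain ⟨hs, hmin⟩ := hθ
  have hsum : ∑ j, θ j = 1 := hs.2
  set m := fun j ↦ affineEst (A j) (b j) y with hm
  have hfo := first_order_of_isMinOn_stdSimplex m
    (fun j ↦ -2 * inner ℝ y (m j) + 2 * σ ^ 2 * (A j).trace + 1 / 2 * ‖m j‖ ^ 2) hs
    (fun θ' hθ' ↦ by
      have := hmin θ' hθ'
      rwa [penalizedCriterion_eq hsum, penalizedCriterion_eq hθ'.2] at this) k
  have hvar := sum_mul_norm_sub_sq hsum m (m k)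
  have hagg : aggregate A b y θ = ∑ j, θ j • m j := aggregate_eq_sum A b y θ
  rw [← hagg] at hfo hvar
  have hin : ∀ z, inner ℝ z (aggregate A b y θ) = ∑ j, θ j * inner ℝ z (m j) := fun z ↦ by
    simp [hagg, inner_sum, inner_smul_right]
  have hdev : ∑ j, θ j * pairDeviation σ A b f y j k =
      2 * (inner ℝ (y - f) (aggregate A b y θ) - inner ℝ (y - f) (m k))
      - 2 * σ ^ 2 * (∑ j, θ j * (A j).trace - (A k).trace)
      - 1 / 2 * ∑ j, θ j * ‖m j - m k‖ ^ 2 := by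
    rw [hin]
    simp only [pairDeviation, inner_sub_right, Matrix.trace_sub, mul_sub, Finset.sum_sub_distrib,
      ← Finset.sum_mul, hsum, one_mul, mul_left_comm (θ _), ← Finset.mul_sum]
    simp [hm]
  have hlin : ∑ j, θ j * (-2 * inner ℝ y (m j) + 2 * σ ^ 2 * (A j).trace + 1 / 2 * ‖m j‖ ^ 2) =
      -2 * inner ℝ y (aggregate A b y θ) + 2 * σ ^ 2 * ∑ j, θ j * (A j).trace +
        1 / 2 * ∑ j, θ j * ‖m j‖ ^ 2 := by
    rw [hin]
    simp only [mul_add, Finset.sum_add_distrib, mul_left_comm (θ _), ← Finset.mul_sum]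
  rw [hlin, inner_sub_right, real_inner_self_eq_norm_sq] at hfo
  rw [hdev, hvar, norm_sub_sq_real, norm_sub_sq_real, inner_sub_left, inner_sub_left,
    real_inner_comm f, real_inner_comm f]
  change _ ≤ ‖m k‖ ^ 2 - 2 * inner ℝ f (m k) + _ + _
  linarith

lemma norm_aggregate_sub_sq_le_of_pairDeviation_le (hθ : θ ∈ argminPenalized σ A b y) {R : ℝ}
    (hR : ∀ j k, pairDeviation σ A b f y j k ≤ R) :
    ‖aggregate A b y θ - f‖ ^ 2 ≤ (⨅ k, ‖affineEst (A k) (b k) y - f‖ ^ 2) + R := by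
  have : Nonempty (Fin M) := by
    by_contra h
    rw [not_nonempty_iff] at h
    simpa using hθ.1.2
  rw [← sub_le_iff_le_add]
  refine le_ciInf fun k ↦ ?_
  have h1 := norm_aggregate_sub_sq_le (f := f) hθ k
  have h2 : ∑ j, θ j * pairDeviation σ A b f y j k ≤ ∑ j, θ j * R :=
    Finset.sum_le_sum fun j _ ↦ mul_le_mul_of_nonneg_left (hR j k) (hθ.1.1 j)
  rw [← Finset.sum_mul, hθ.1.2, one_mul] at h2
  linarith

/-- The loss of an aggregate with weights in the simplex, by convexity. -/
lemma norm_aggregate_sub_sq_le_sum (hθ : θ ∈ stdSimplex ℝ (Fin M)) :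
    ‖aggregate A b y θ - f‖ ^ 2 ≤ ∑ j, ‖affineEst (A j) (b j) y - f‖ ^ 2 := by
  have hsum : ∑ j, θ j = 1 := hθ.2
  have h : aggregate A b y θ - f = ∑ j, θ j • (affineEst (A j) (b j) y - f) := by
    simp only [aggregate_eq_sum, smul_sub, Finset.sum_sub_distrib, ← Finset.sum_smul, hsum,
      one_smul]
  have hcvx : ConvexOn ℝ Set.univ fun z : EuclideanSpace ℝ (Fin n) ↦ ‖z‖ ^ 2 :=
    convexOn_univ_norm.pow (fun _ _ ↦ norm_nonneg _) 2
  rw [h]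
  refine (hcvx.map_sum_le (fun i _ ↦ hθ.1 i) hsum fun _ _ ↦ Set.mem_univ _).trans ?_
  exact Finset.sum_le_sum fun j _ ↦ mul_le_of_le_one_left (by positivity)
    (hsum ▸ Finset.single_le_sum (fun i _ ↦ hθ.1 i) (Finset.mem_univ j))

end

/-! ### Exponential moments of the pairwise deviations -/

lemma trace_toEuclideanCLM {n : ℕ} (B : Matrix (Fin n) (Fin n) ℝ) :
    LinearMap.trace ℝ (EuclideanSpace ℝ (Fin n))
      (Matrix.toEuclideanCLM (𝕜 := ℝ) B :
        EuclideanSpace ℝ (Fin n) →ₗ[ℝ] EuclideanSpace ℝ (Fin n)) = B.trace := by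
  rw [Matrix.coe_toEuclideanCLM_eq_toEuclideanLin, Matrix.toEuclideanLin_eq_toLin_orthonormal,
    Matrix.trace_toLin_eq]

section
variable {Ω : Type*} [MeasurableSpace Ω] {P : Measure Ω}
  {n M : ℕ} {σ : ℝ≥0} {ξ : Fin n → Ω → ℝ}

lemma hasLaw_stdGaussian_inv_smul_toLp (hσ : σ ≠ 0) (hξ_indep : iIndepFun ξ P)
    (hξ_law : ∀ i, HasLaw (ξ i) (gaussianReal 0 (σ ^ 2)) P) :
    HasLaw (fun ω ↦ (σ : ℝ)⁻¹ • WithLp.toLp 2 (fun i ↦ ξ i ω))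
      (stdGaussian (EuclideanSpace ℝ (Fin n))) P := by
  have hlaw : ∀ i, HasLaw (fun ω ↦ (σ : ℝ)⁻¹ * ξ i ω) (gaussianReal 0 1) P := by
    intro i
    have h := gaussianReal_const_mul (hξ_law i) (σ : ℝ)⁻¹
    have h1 : (NNReal.mk (((σ : ℝ)⁻¹) ^ 2) (sq_nonneg _)) * σ ^ 2 = 1 := by
      ext
      have : (σ : ℝ) ≠ 0 := by exact_mod_cast hσ
      simp only [NNReal.coe_mul, NNReal.coe_mk, NNReal.coe_pow, NNReal.coe_one]
      field_simp
    rwa [h1, mul_zero] at h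
  have hind : iIndepFun (fun i ω ↦ (σ : ℝ)⁻¹ * ξ i ω) P :=
    hξ_indep.comp (fun _ x ↦ (σ : ℝ)⁻¹ * x) fun _ ↦ by fun_prop
  have hpi := hind.hasLaw_pi hlaw
  have hmap : HasLaw (WithLp.toLp 2) (stdGaussian (EuclideanSpace ℝ (Fin n)))
      (Measure.pi fun _ : Fin n ↦ gaussianReal 0 1) := ⟨by fun_prop, map_pi_eq_stdGaussian⟩
  exact hmap.comp hpi

lemma ae_eq_zero_of_variance_zero (hσ : σ = 0)
    (hξ_law : ∀ i, HasLaw (ξ i) (gaussianReal 0 (σ ^ 2)) P) :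
    ∀ᵐ ω ∂P, WithLp.toLp 2 (fun i ↦ ξ i ω) = (0 : EuclideanSpace ℝ (Fin n)) := by
  have h : ∀ i, ∀ᵐ ω ∂P, ξ i ω = 0 := fun i ↦ by
    have := hξ_law i
    rw [hσ, zero_pow two_ne_zero, gaussianReal_zero_var] at this
    exact this.ae_eq_of_dirac
  filter_upwards [ae_all_iff.2 h] with ω hω
  ext i
  simp [hω i]

variable {A : Fin M → Matrix (Fin n) (Fin n) ℝ} {b : Fin M → EuclideanSpace ℝ (Fin n)}
  {f : EuclideanSpace ℝ (Fin n)}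

lemma affineEst_sub_affineEst (A A' : Matrix (Fin n) (Fin n) ℝ)
    (b b' y : EuclideanSpace ℝ (Fin n)) :
    affineEst A b y - affineEst A' b' y =
      Matrix.toEuclideanCLM (𝕜 := ℝ) (A - A') y + (b - b') := by
  simp only [affineEst, map_sub, sub_apply]
  abel

/-- In the coordinates `g = ξ / σ` the normalized deviation is an affine Gaussian chaos. -/
lemma pairDeviation_div_eq (hσ : σ ≠ 0) (x : EuclideanSpace ℝ (Fin n)) (j k : Fin M) :
    pairDeviation σ A b f (f + x) j k / (46 * (σ : ℝ) ^ 2) =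
      (2 * inner ℝ ((σ : ℝ)⁻¹ • x) (Matrix.toEuclideanCLM (𝕜 := ℝ) (A j - A k) ((σ : ℝ)⁻¹ • x) +
          (σ : ℝ)⁻¹ • (Matrix.toEuclideanCLM (𝕜 := ℝ) (A j - A k) f + (b j - b k)))
        - 2 * LinearMap.trace ℝ (EuclideanSpace ℝ (Fin n))
          (Matrix.toEuclideanCLM (𝕜 := ℝ) (A j - A k) :
            EuclideanSpace ℝ (Fin n) →ₗ[ℝ] EuclideanSpace ℝ (Fin n))
        - 1 / 2 * ‖Matrix.toEuclideanCLM (𝕜 := ℝ) (A j - A k) ((σ : ℝ)⁻¹ • x) +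
          (σ : ℝ)⁻¹ • (Matrix.toEuclideanCLM (𝕜 := ℝ) (A j - A k) f + (b j - b k))‖ ^ 2) / 46 := by
  have hσ' : (σ : ℝ) ≠ 0 := by exact_mod_cast hσ
  have h : Matrix.toEuclideanCLM (𝕜 := ℝ) (A j - A k) ((σ : ℝ)⁻¹ • x) +
      (σ : ℝ)⁻¹ • (Matrix.toEuclideanCLM (𝕜 := ℝ) (A j - A k) f + (b j - b k)) =
      (σ : ℝ)⁻¹ • (affineEst (A j) (b j) (f + x) - affineEst (A k) (b k) (f + x)) := by
    rw [affineEst_sub_affineEst, map_smul, ← smul_add, map_add]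
    congr 1
    abel
  rw [h, trace_toEuclideanCLM, real_inner_smul_left, inner_smul_right, norm_smul, mul_pow,
    Real.norm_eq_abs, sq_abs, pairDeviation, add_sub_cancel_left]
  field_simp

lemma exp_pairDeviation_div (hσ : σ ≠ 0) (hA : ∀ j, opNorm (A j) ≤ 1) (hξ_indep : iIndepFun ξ P)
    (hξ_law : ∀ i, HasLaw (ξ i) (gaussianReal 0 (σ ^ 2)) P) (j k : Fin M) :
    Integrable (fun ω ↦ Real.exp (pairDeviation σ A b f (observation f fun i ↦ ξ i ω) j k /
      (46 * (σ : ℝ) ^ 2))) P ∧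
    ∫ ω, Real.exp (pairDeviation σ A b f (observation f fun i ↦ ξ i ω) j k /
      (46 * (σ : ℝ) ^ 2)) ∂P ≤ 1 := by
  have hX := hasLaw_stdGaussian_inv_smul_toLp hσ hξ_indep hξ_law
  have hB : ‖Matrix.toEuclideanCLM (𝕜 := ℝ) (A j - A k)‖ ≤ 2 := by
    rw [map_sub]
    refine (norm_sub_le _ _).trans ?_
    have h1 := hA j
    have h2 := hA k
    simp only [opNorm] at h1 h2
    linarith
  have key := exp_affine_chaos_stdGaussian _ hB
    ((σ : ℝ)⁻¹ • (Matrix.toEuclideanCLM (𝕜 := ℝ) (A j - A k) f + (b j - b k)))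
  simp only [observation, pairDeviation_div_eq hσ]
  refine ⟨?_, ?_⟩
  · rw [← hX.map_eq] at key
    exact key.1.comp_aemeasurable hX.aemeasurable
  · exact (hX.integral_comp key.1.aestronglyMeasurable).trans_le key.2

variable [IsProbabilityMeasure P]

/-- A single random variable `S` with `𝔼 S ≤ M²` whose logarithm dominates all pairwise deviations:
the sum of their exponentials. -/
lemma exists_integral_le_sq_and_pairDeviation_le (hM : M ≠ 0) (hA : ∀ j, opNorm (A j) ≤ 1)
    (hξ_indep : iIndepFun ξ P) (hξ_law : ∀ i, HasLaw (ξ i) (gaussianReal 0 (σ ^ 2)) P) :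
    ∃ S : Ω → ℝ, Integrable S P ∧ (∀ ω, 0 < S ω) ∧ ∫ ω, S ω ∂P ≤ (M : ℝ) ^ 2 ∧
      ∀ᵐ ω ∂P, ∀ j k, pairDeviation σ A b f (observation f fun i ↦ ξ i ω) j k ≤
        46 * (σ : ℝ) ^ 2 * Real.log (S ω) := by
  rcases eq_or_ne σ 0 with hσ | hσ
  · -- without noise every deviation is at most zero, and `S = 1` serves
    refine ⟨fun _ ↦ 1, integrable_const _, fun _ ↦ one_pos, ?_, ?_⟩
    · simpa using Nat.one_le_iff_ne_zero.2 hM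
    · filter_upwards [ae_eq_zero_of_variance_zero hσ hξ_law] with ω hω j k
      simp only [observation, hω, hσ, pairDeviation]
      simp only [add_zero, sub_self, inner_zero_left, NNReal.coe_zero]
      nlinarith [sq_nonneg ‖affineEst (A j) (b j) f - affineEst (A k) (b k) f‖]
  · have : NeZero M := ⟨hM⟩
    have key := exp_pairDeviation_div (b := b) (f := f) hσ hA hξ_indep hξ_law
    refine ⟨fun ω ↦ ∑ j, ∑ k, Real.exp (pairDeviation σ A b f (observation f fun i ↦ ξ i ω) j k /
      (46 * (σ : ℝ) ^ 2)), integrable_finsetSum _ fun j _ ↦ integrable_finsetSum _ fun k _ ↦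
        (key j k).1, fun ω ↦ ?_, ?_, ?_⟩
    · exact Finset.sum_pos (fun _ _ ↦ Finset.sum_pos (fun _ _ ↦ Real.exp_pos _)
        Finset.univ_nonempty) Finset.univ_nonempty
    · rw [integral_finsetSum _ fun j _ ↦ integrable_finsetSum _ fun k _ ↦ (key j k).1]
      simp_rw [integral_finsetSum _ fun k _ ↦ (key _ k).1]
      calc _ ≤ ∑ _j : Fin M, ∑ _k : Fin M, (1 : ℝ) :=
            Finset.sum_le_sum fun j _ ↦ Finset.sum_le_sum fun k _ ↦ (key j k).2
        _ = (M : ℝ) ^ 2 := by simp [sq]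
    · refine ae_of_all _ fun ω j k ↦ ?_
      have hpos : 0 < 46 * (σ : ℝ) ^ 2 := by positivity
      rw [← div_le_iff₀' hpos, ← Real.log_exp (_ / _)]
      refine Real.log_le_log (Real.exp_pos _) ?_
      exact (Finset.single_le_sum (f := fun k ↦ Real.exp (pairDeviation σ A b f
          (observation f fun i ↦ ξ i ω) j k / (46 * (σ : ℝ) ^ 2)))
          (fun _ _ ↦ (Real.exp_pos _).le) (Finset.mem_univ k)).trans
        (Finset.single_le_sum (f := fun j ↦ ∑ k, Real.exp (pairDeviation σ A b f
          (observation f fun i ↦ ξ i ω) j k / (46 * (σ : ℝ) ^ 2)))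
          (fun _ _ ↦ Finset.sum_nonneg fun _ _ ↦ (Real.exp_pos _).le) (Finset.mem_univ j))

/-! ### Tail and mean of a variable bounded by a logarithm -/

lemma one_sub_exp_neg_le_measureReal_log_le {S : Ω → ℝ} (hS : Integrable S P)
    (hpos : ∀ ω, 0 < S ω) {K : ℝ} (hK : 0 < K) (hint : ∫ ω, S ω ∂P ≤ K) (x : ℝ) :
    1 - Real.exp (-x) ≤ P.real {ω | Real.log (S ω) ≤ Real.log K + x} := by
  have hmarkov := mul_meas_ge_le_integral_of_nonneg (ae_of_all P fun ω ↦ (hpos ω).le) hS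
    (K * Real.exp x)
  have hnull : NullMeasurableSet {ω | K * Real.exp x ≤ S ω} P :=
    hS.aemeasurable.nullMeasurable measurableSet_Ici
  have htail : P.real {ω | K * Real.exp x ≤ S ω} ≤ Real.exp (-x) := by
    rw [Real.exp_neg, ← one_div, le_div_iff₀ (Real.exp_pos x)]
    refine le_of_mul_le_mul_left (a := K) ?_ hK
    linarith
  have hcompl := probReal_compl_eq_one_sub₀ hnull
  refine (by linarith : 1 - Real.exp (-x) ≤ P.real {ω | K * Real.exp x ≤ S ω}ᶜ).trans
    (measureReal_mono fun ω hω ↦ ?_)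
  have hω : S ω < K * Real.exp x := not_le.1 hω
  have := Real.log_le_log (hpos ω) hω.le
  rwa [Real.log_mul hK.ne' (Real.exp_pos x).ne', Real.log_exp] at this

lemma integral_le_add_log_of_le {S U V : Ω → ℝ} (hS : Integrable S P) (hpos : ∀ ω, 0 < S ω)
    {K c : ℝ} (hK : 0 < K) (hint : ∫ ω, S ω ∂P ≤ K) (hc : 0 ≤ c) (hU : Integrable U P)
    (hV : Integrable V P) (h : ∀ᵐ ω ∂P, U ω ≤ V ω + c * Real.log (S ω)) :
    ∫ ω, U ω ∂P ≤ ∫ ω, V ω ∂P + c * Real.log K := by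
  have hb : ∀ᵐ ω ∂P, U ω ≤ V ω + c * (S ω / K + (Real.log K - 1)) := by
    filter_upwards [h] with ω hω
    have h1 := Real.log_le_sub_one_of_pos (div_pos (hpos ω) hK)
    rw [Real.log_div (hpos ω).ne' hK.ne'] at h1
    nlinarith
  have hi : Integrable (fun ω ↦ c * (S ω / K + (Real.log K - 1))) P :=
    ((hS.div_const K).add (integrable_const _)).const_mul c
  refine (integral_mono_ae hU (hV.add hi) hb).trans ?_
  simp only [Pi.add_apply]
  rw [integral_add hV hi, integral_const_mul, integral_add (hS.div_const K) (integrable_const _),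
    integral_div, integral_const]
  have : (∫ ω, S ω ∂P) / K ≤ 1 := (div_le_one hK).2 hint
  simp only [probReal_univ, one_smul]
  nlinarith

/-! ### Integrability of the losses -/

lemma memLp_two_observation (f : EuclideanSpace ℝ (Fin n))
    (hξ_law : ∀ i, HasLaw (ξ i) (gaussianReal 0 (σ ^ 2)) P) :
    MemLp (fun ω ↦ observation f fun i ↦ ξ i ω) 2 P := by
  refine (memLp_const f).add (MemLp.of_eval_piLp fun i ↦ ?_)
  have h := memLp_id_gaussianReal (μ := 0) (v := σ ^ 2) 2
  rw [← (hξ_law i).map_eq] at h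
  exact h.comp_of_map (hξ_law i).aemeasurable

lemma memLp_two_affineEst_sub (B : Matrix (Fin n) (Fin n) ℝ) (c f : EuclideanSpace ℝ (Fin n))
    {Y : Ω → EuclideanSpace ℝ (Fin n)} (hY : MemLp Y 2 P) :
    MemLp (fun ω ↦ affineEst B c (Y ω) - f) 2 P :=
  (((Matrix.toEuclideanCLM (𝕜 := ℝ) B).comp_memLp' hY).add (memLp_const c)).sub (memLp_const f)

lemma integrable_iInf_norm_affineEst_sub_sq (hM : M ≠ 0) {Y : Ω → EuclideanSpace ℝ (Fin n)}
    (hY : MemLp Y 2 P) :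
    Integrable (fun ω ↦ ⨅ j, ‖affineEst (A j) (b j) (Y ω) - f‖ ^ 2) P := by
  have : NeZero M := ⟨hM⟩
  have hm : Measurable fun z ↦ ⨅ j, ‖affineEst (A j) (b j) z - f‖ ^ 2 := by
    refine Measurable.iInf fun j ↦ ?_
    unfold affineEst
    fun_prop
  refine (memLp_two_affineEst_sub (A 0) (b 0) f hY).integrable_norm_pow two_ne_zero |>.mono'
    (hm.comp_aemeasurable hY.aestronglyMeasurable.aemeasurable).aestronglyMeasurable
    (ae_of_all _ fun ω ↦ ?_)
  have h0 : ∀ j, 0 ≤ ‖affineEst (A j) (b j) (Y ω) - f‖ ^ 2 := fun j ↦ by positivity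
  rw [Real.norm_of_nonneg (Real.iInf_nonneg h0)]
  exact ciInf_le ⟨0, by rintro _ ⟨j, rfl⟩; exact h0 j⟩ 0

lemma integrable_norm_aggregate_sub_sq {Y : Ω → EuclideanSpace ℝ (Fin n)} (hY : MemLp Y 2 P)
    {θ : Ω → Fin M → ℝ} (hθ_meas : AEMeasurable θ P) (hθ : ∀ ω, θ ω ∈ stdSimplex ℝ (Fin M)) :
    Integrable (fun ω ↦ ‖aggregate A b (Y ω) (θ ω) - f‖ ^ 2) P := by
  have hYm := hY.aestronglyMeasurable.aemeasurable
  have hm : AEMeasurable (fun ω ↦ ‖aggregate A b (Y ω) (θ ω) - f‖ ^ 2) P := by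
    simp only [aggregate_eq_sum, affineEst]
    fun_prop
  refine (integrable_finsetSum Finset.univ fun j _ ↦
    (memLp_two_affineEst_sub (A j) (b j) f hY).integrable_norm_pow two_ne_zero).mono'
    hm.aestronglyMeasurable (ae_of_all _ fun ω ↦ ?_)
  rw [Real.norm_of_nonneg (by positivity)]
  exact norm_aggregate_sub_sq_le_sum (hθ ω)

end
end AffineAggregation

open AffineAggregation in
theorem mainTheorem1 {Ω : Type*} [MeasurableSpace Ω] (P : Measure Ω) [IsProbabilityMeasure P]
    (n M : ℕ) (hM : 2 ≤ M) (σ : ℝ≥0)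
    (f : EuclideanSpace ℝ (Fin n))
    (A : Fin M → Matrix (Fin n) (Fin n) ℝ) (b : Fin M → EuclideanSpace ℝ (Fin n))
    (hA : ∀ j, AffineAggregation.opNorm (A j) ≤ 1)
    (ξ : Fin n → Ω → ℝ)
    (hξ_indep : iIndepFun ξ P)
    (hξ_law : ∀ i, HasLaw (ξ i) (gaussianReal 0 (σ ^ 2)) P)
    (y : Ω → EuclideanSpace ℝ (Fin n))
    (hy : ∀ ω, y ω = AffineAggregation.observation f (fun i => ξ i ω))
    (θhat : Ω → Fin M → ℝ) (hθ_meas : AEMeasurable θhat P)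
    (hθ : ∀ ω, θhat ω ∈ AffineAggregation.argminPenalized (σ : ℝ) A b (y ω)) :
    (∀ x : ℝ, 0 < x →
      1 - 2 * Real.exp (-x) <
        P.real {ω | ‖AffineAggregation.aggregate A b (y ω) (θhat ω) - f‖ ^ 2 ≤
          (⨅ j, ‖AffineAggregation.affineEst (A j) (b j) (y ω) - f‖ ^ 2)
            + 46 * (σ : ℝ) ^ 2 * (2 * Real.log M + x)}) ∧
    Integrable (fun ω => ‖AffineAggregation.aggregate A b (y ω) (θhat ω) - f‖ ^ 2) P ∧
    Integrable (fun ω => ⨅ j, ‖AffineAggregation.affineEst (A j) (b j) (y ω) - f‖ ^ 2) P ∧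
    ∫ ω, ‖AffineAggregation.aggregate A b (y ω) (θhat ω) - f‖ ^ 2 ∂P ≤
      (∫ ω, ⨅ j, ‖AffineAggregation.affineEst (A j) (b j) (y ω) - f‖ ^ 2 ∂P)
        + 92 * (σ : ℝ) ^ 2 * Real.log (Real.exp 1 * M) := by
  have hM0 : M ≠ 0 := by omega
  have hMpos : (0 : ℝ) < M := by exact_mod_cast Nat.pos_of_ne_zero hM0
  have hlogK : Real.log ((M : ℝ) ^ 2) = 2 * Real.log M := by simp
  obtain rfl : y = fun ω ↦ observation f fun i ↦ ξ i ω := funext hy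
  obtain ⟨S, hS, hpos, hint, hdev⟩ :=
    exists_integral_le_sq_and_pairDeviation_le (b := b) (f := f) hM0 hA hξ_indep hξ_law
  have hbound : ∀ᵐ ω ∂P, ‖aggregate A b (observation f fun i ↦ ξ i ω) (θhat ω) - f‖ ^ 2 ≤
      (⨅ j, ‖affineEst (A j) (b j) (observation f fun i ↦ ξ i ω) - f‖ ^ 2) +
        46 * (σ : ℝ) ^ 2 * Real.log (S ω) := by
    filter_upwards [hdev] with ω hω
    exact norm_aggregate_sub_sq_le_of_pairDeviation_le (hθ ω) hω
  have hY := memLp_two_observation f hξ_law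
  have hagg := integrable_norm_aggregate_sub_sq (A := A) (b := b) (f := f) hY hθ_meas
    fun ω ↦ (hθ ω).1
  have hmin := integrable_iInf_norm_affineEst_sub_sq (A := A) (b := b) (f := f) hM0 hY
  refine ⟨fun x _ ↦ ?_, hagg, hmin, ?_⟩
  · have htail := one_sub_exp_neg_le_measureReal_log_le hS hpos (by positivity) hint x
    have hle : P.real {ω | Real.log (S ω) ≤ Real.log ((M : ℝ) ^ 2) + x} ≤ _ :=
      ENNReal.toReal_mono (measure_ne_top P _) (measure_mono_ae (t := {ω |
        ‖aggregate A b (observation f fun i ↦ ξ i ω) (θhat ω) - f‖ ^ 2 ≤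
          (⨅ j, ‖affineEst (A j) (b j) (observation f fun i ↦ ξ i ω) - f‖ ^ 2)
            + 46 * (σ : ℝ) ^ 2 * (2 * Real.log M + x)}) (by
        filter_upwards [hbound] with ω hω hlog
        refine hω.trans (add_le_add_right (mul_le_mul_of_nonneg_left ?_ (by positivity)) _)
        rw [← hlogK]
        exact hlog))
    refine lt_of_lt_of_le ?_ (htail.trans hle)
    linarith [Real.exp_pos (-x)]
  · have h := integral_le_add_log_of_le hS hpos (by positivity) hint
      (by positivity : 0 ≤ 46 * (σ : ℝ) ^ 2) hagg hmin hbound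
    rw [hlogK] at h
    rw [Real.log_mul (Real.exp_pos 1).ne' hMpos.ne', Real.log_exp]
    nlinarith [sq_nonneg (σ : ℝ)]
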